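/- Let $P_3$ be the path with three vertices $0,1,2$, and let $P_3^n$ be the Cartesian product of $n$ copies of $P_3$: its vertex set is $\{0,1,2\}^n$, and $x,y$ are adjacent iff $|x_i-y_i|=1$ for some $i$ and $x_j=y_j$ for all $j\ne i$. For $p\in[0,1]$ let $P_{3,p}^n$ be the random subgraph of $P_3^n$ that contains all vertices and contains each edge of $P_3^n$ independently with probability $p$. Let $C_s$ be the family of sets of $s$ vertices of $P_3^n$ whose induced subgraph in $P_3^n$ is connected. **Theorem.** Fix $p$ with $2-\sqrt2\le p\le 1$. Then the probability that there are an integer $s$ with $2\le s\le 3^{0.44n}$ and a set $S\in C_s$ such that no edge of $P_{3,p}^n$ joins $S$ to $V(P_3^n)\setminus S$ tends to $0$ as $n\to\infty$. -/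

import Mathlib

open MeasureTheory ProbabilityTheory Filter Topology

/-- The Cartesian product of `n` copies of a graph `G`: two vertices are adjacent when they are
adjacent in `G` in one coordinate and agree in all the others. -/
def boxPower {V : Type*} (G : SimpleGraph V) (n : ℕ) : SimpleGraph (Fin n → V) where
  Adj x y := ∃ i, G.Adj (x i) (y i) ∧ ∀ j, j ≠ i → x j = y j
  symm := ⟨fun _ _ ⟨i, h, h'⟩ => ⟨i, h.symm, fun j hj => (h' j hj).symm⟩⟩
  loopless := ⟨fun _ ⟨_, h, _⟩ => h.ne rfl⟩

/-- `P_3^n`, the Cartesian product of `n` copies of the path with three vertices. -/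
def pathThreePower (n : ℕ) : SimpleGraph (Fin n → Fin 3) :=
  boxPower (SimpleGraph.pathGraph 3) n

/-- The law of the random subgraph of `G` (bond percolation with parameter `p`): all vertices of
`G` are kept, and each edge of `G` is kept independently with probability `p`. -/
noncomputable def randomSubgraph {V : Type*} (G : SimpleGraph V) (p : unitInterval) :
    Measure (SimpleGraph V) :=
  (setBernoulli G.edgeSet p).map SimpleGraph.fromEdgeSet

/-- The sets of `s` vertices of `G` whose induced subgraph is connected. -/
def connectedSets {V : Type*} (G : SimpleGraph V) (s : ℕ) : Set (Finset V) :=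
  {S | S.card = s ∧ (G.induce (S : Set V)).Connected}

/-- No edge of `H` joins `S` to its complement. -/
def IsSeparated {V : Type*} (H : SimpleGraph V) (S : Finset V) : Prop :=
  ∀ u ∈ S, ∀ v ∉ S, ¬ H.Adj u v

/-! ### Edges inside a set of vertices of a grid -/

/-! First-moment bound. Every vertex has degree at least `n`, and `s` vertices span at most `(s / 2)
* log₂ s` edges (`card_interedges_self_le`), so at least `s * (n - log₂ s)` edges leave a set of
size `s`. Encoding connected sets by closed walks around spanning trees shows that there are at most
`3 ^ n * (3 * n) ^ (2 * (s - 1))` of them. As `1 - p ≤ √2 - 1 < 0.42`, the expected number of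
separated connected `s`-sets is at most `3 ^ n * (9 * n ^ 2 * 0.42 ^ (n - log₂ s)) ^ s`.

For bounded `s` the loss from `log₂ s` is a constant factor, and `3 * 0.42 ^ 2 < 1` suffices from `s
= 2` on; since `3 * 0.42 > 1`, this bound fails for single vertices. For larger `s`, `log₂ s ≤ 0.7 *
n` leaves a base of at most `0.78 ^ n`, and the high power `s` beats `3 ^ n`. -/

lemma boxPower_pathGraph_adj_of_lt {m n : ℕ} {x y : Fin n → Fin m} {i : Fin n}
    (h : (boxPower (SimpleGraph.pathGraph m) n).Adj x y) (hi : x i < y i) :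
    (x i).val + 1 = (y i).val ∧ ∀ j, j ≠ i → x j = y j := by
  obtain ⟨k, hk, hk'⟩ := h
  obtain rfl : i = k := by
    by_contra hik
    exact hi.ne (hk' i hik)
  rw [SimpleGraph.pathGraph_adj] at hk
  exact ⟨by have := Fin.lt_def.1 hi; omega, hk'⟩

open Classical in
/-- Two sets separated by a coordinate hyperplane span at most as many edges as the smaller one
has points. -/
lemma card_interedges_le_of_lt {m n : ℕ} (A B : Finset (Fin n → Fin m)) (i : Fin n) (c : Fin m)
    (hA : ∀ x ∈ A, x i ≤ c) (hB : ∀ x ∈ B, c < x i) :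
    ((boxPower (SimpleGraph.pathGraph m) n).interedges A B).card ≤ min A.card B.card := by
  have key : ∀ z ∈ (boxPower (SimpleGraph.pathGraph m) n).interedges A B,
      (z.1 i).val = c ∧ (z.2 i).val = c + 1 ∧ ∀ j, j ≠ i → z.1 j = z.2 j := by
    rintro ⟨x, y⟩ hz
    obtain ⟨hx, hy, hxy⟩ := (SimpleGraph.mem_interedges_iff _).1 hz
    have h1 : x i ≤ c := hA x hx
    have h2 : c < y i := hB y hy
    obtain ⟨h3, h4⟩ := boxPower_pathGraph_adj_of_lt (x := x) (y := y) hxy (h1.trans_lt h2)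
    rw [Fin.le_def] at h1
    rw [Fin.lt_def] at h2
    exact ⟨show (x i).val = c by omega, show (y i).val = c + 1 by omega, h4⟩
  refine le_min ?_ ?_
  · refine Finset.card_le_card_of_injOn Prod.fst
      (fun z hz => ((SimpleGraph.mem_interedges_iff _).1 hz).1) ?_
    rintro ⟨x, y⟩ hz ⟨x', y'⟩ hz' (rfl : x = x')
    obtain ⟨-, h1, h2⟩ := key _ hz
    obtain ⟨-, h1', h2'⟩ := key _ hz'
    refine Prod.ext rfl (funext fun j => ?_)
    rcases eq_or_ne j i with rfl | hj
    · exact Fin.ext (h1.trans h1'.symm)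
    · exact (h2 j hj).symm.trans (h2' j hj)
  · refine Finset.card_le_card_of_injOn Prod.snd
      (fun z hz => ((SimpleGraph.mem_interedges_iff _).1 hz).2.1) ?_
    rintro ⟨x, y⟩ hz ⟨x', y'⟩ hz' (rfl : y = y')
    obtain ⟨h1, -, h2⟩ := key _ hz
    obtain ⟨h1', -, h2'⟩ := key _ hz'
    refine Prod.ext (funext fun j => ?_) rfl
    rcases eq_or_ne j i with rfl | hj
    · exact Fin.ext (h1.trans h1'.symm)
    · exact (h2 j hj).trans (h2' j hj).symm

/-- By concavity, entropy lies above its chord from `0` to `1 / 2`. -/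
lemma two_mul_log_two_le_binEntropy {t : ℝ} (h0 : 0 ≤ t) (h1 : t ≤ 2⁻¹) :
    2 * t * Real.log 2 ≤ Real.binEntropy t := by
  have h := Real.strictConcave_binEntropy.concaveOn.2 (by simp : (0 : ℝ) ∈ _)
    (by constructor <;> norm_num : (2⁻¹ : ℝ) ∈ _) (by linarith : 0 ≤ 1 - 2 * t)
    (by linarith : 0 ≤ 2 * t) (by ring)
  simp only [Real.binEntropy_zero, Real.binEntropy_two_inv, smul_eq_mul, mul_zero, zero_add] at h
  rwa [show 2 * t * 2⁻¹ = t by ring] at h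

/-- The entropy bound at `t = a / (a + b)`, scaled by `a + b`. It is the induction step of the
isoperimetric inequality: `2 * min a b` pays for the edges between the two halves. -/
lemma mul_logb_add_le {a b : ℝ} (ha : 0 < a) (hb : 0 < b) :
    a * Real.logb 2 a + b * Real.logb 2 b + 2 * min a b ≤ (a + b) * Real.logb 2 (a + b) := by
  wlog hab : a ≤ b generalizing a b
  · have := this hb ha (le_of_not_ge hab)
    rw [min_comm, add_comm a b]
    linarith
  rw [min_eq_left hab]
  have h2 : 0 < Real.log 2 := Real.log_pos one_lt_two
  have hs : 0 < a + b := by positivity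
  have h := two_mul_log_two_le_binEntropy (t := a / (a + b)) (by positivity)
    (by rw [div_le_iff₀ hs]; linarith)
  have h1 : 1 - a / (a + b) = b / (a + b) := by field_simp; ring
  rw [Real.binEntropy, h1, Real.log_inv, Real.log_inv, Real.log_div ha.ne' hs.ne',
    Real.log_div hb.ne' hs.ne'] at h
  have h3 := mul_le_mul_of_nonneg_left h hs.le
  have h4 : (a + b) * (a / (a + b) * -(Real.log a - Real.log (a + b)) +
      b / (a + b) * -(Real.log b - Real.log (a + b))) =
      (a + b) * Real.log (a + b) - a * Real.log a - b * Real.log b := by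
    field_simp
    ring
  have h5 : (a + b) * (2 * (a / (a + b)) * Real.log 2) = 2 * a * Real.log 2 := by
    field_simp
  rw [h4, h5] at h3
  simp only [Real.logb]
  rw [← mul_le_mul_iff_left₀ h2]
  field_simp
  linarith

open Classical in
/-- Edge-isoperimetric inequality in a grid: a set of `s` vertices spans at most
`(s / 2) * log₂ s` edges. -/
theorem card_interedges_self_le {m n : ℕ} (S : Finset (Fin n → Fin m)) :
    (((boxPower (SimpleGraph.pathGraph m) n).interedges S S).card : ℝ) ≤
      S.card * Real.logb 2 S.card := by
  induction hs : S.card using Nat.strong_induction_on generalizing S with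
  | _ s ih =>
  subst hs
  set G := boxPower (SimpleGraph.pathGraph m) n with hG
  by_cases hS : (S : Set (Fin n → Fin m)).Subsingleton
  · have h0 : G.interedges S S = ∅ := by
      refine Finset.eq_empty_of_forall_notMem fun z hz => ?_
      obtain ⟨hx, hy, hxy⟩ := (SimpleGraph.mem_interedges_iff _).1 hz
      exact hxy.ne (hS hx hy)
    rw [h0, Finset.card_empty, Nat.cast_zero]
    rcases Nat.eq_zero_or_pos S.card with h | h
    · simp [h]
    · exact mul_nonneg (Nat.cast_nonneg _)
        (Real.logb_nonneg one_lt_two (Nat.one_le_cast.2 h))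
  -- Cutting at height `x i` leaves `x` and `y` on different sides, so both parts are strictly
  -- smaller than `S`.
  obtain ⟨x, hx, y, hy, i, hi⟩ : ∃ x ∈ S, ∃ y ∈ S, ∃ i, x i < y i := by
    rw [Set.not_subsingleton_iff] at hS
    obtain ⟨x, hx, y, hy, hxy⟩ := hS
    obtain ⟨i, hi⟩ := Function.ne_iff.1 hxy
    rcases lt_or_gt_of_ne hi with h | h
    · exact ⟨x, hx, y, hy, i, h⟩
    · exact ⟨y, hy, x, hx, i, h⟩
  set A := S.filter fun z => z i ≤ x i with hA
  set B := S.filter fun z => ¬ z i ≤ x i with hB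
  have hAB : A.card + B.card = S.card := Finset.card_filter_add_card_filter_not _
  have hA0 : 0 < A.card := Finset.card_pos.2 ⟨x, Finset.mem_filter.2 ⟨hx, le_rfl⟩⟩
  have hB0 : 0 < B.card := Finset.card_pos.2 ⟨y, Finset.mem_filter.2 ⟨hy, hi.not_ge⟩⟩
  have hcross : (G.interedges A B).card ≤ min A.card B.card :=
    card_interedges_le_of_lt A B i (x i) (fun z hz => (Finset.mem_filter.1 hz).2)
      (fun z hz => not_le.1 (Finset.mem_filter.1 hz).2)
  -- `interedges` counts ordered pairs, so each crossing edge counts twice.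
  have hcross' : (G.interedges B A).card ≤ min A.card B.card := by
    have := G.symm
    rwa [SimpleGraph.interedges, Rel.card_interedges_comm]
  have hsub : G.interedges S S ⊆
      (G.interedges A A ∪ G.interedges B B) ∪ (G.interedges A B ∪ G.interedges B A) := by
    rintro ⟨u, v⟩ huv
    simp only [Finset.mem_union, SimpleGraph.mem_interedges_iff, hA, hB, Finset.mem_filter] at huv ⊢
    tauto
  have hcard : (G.interedges S S).card ≤ ((G.interedges A A).card + (G.interedges B B).card) +
      ((G.interedges A B).card + (G.interedges B A).card) :=
    (Finset.card_le_card hsub).trans ((Finset.card_union_le _ _).trans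
      (add_le_add (Finset.card_union_le _ _) (Finset.card_union_le _ _)))
  have h1 := ih A.card (by omega) A rfl
  have h2 := ih B.card (by omega) B rfl
  have h3 := mul_logb_add_le (Nat.cast_pos (α := ℝ).2 hA0) (Nat.cast_pos (α := ℝ).2 hB0)
  rw [← Nat.cast_add, hAB] at h3
  have h4 : ((G.interedges S S).card : ℝ) ≤ (G.interedges A A).card + (G.interedges B B).card +
      2 * min (A.card : ℝ) B.card := by
    have : (G.interedges S S).card ≤ (G.interedges A A).card + (G.interedges B B).card +
      2 * min A.card B.card := by omega
    exact_mod_cast this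
  linarith

open Classical in
lemma le_card_filter_pathThreePower_adj {n : ℕ} (x : Fin n → Fin 3) :
    n ≤ (Finset.univ.filter fun y => (pathThreePower n).Adj x y).card := by
  -- One neighbour in each coordinate direction already gives degree `n`.
  set f : Fin 3 → Fin 3 := fun a => if a = 1 then 0 else 1 with hf
  have hfa : ∀ a, (SimpleGraph.pathGraph 3).Adj a (f a) := by
    intro a
    rw [SimpleGraph.pathGraph_adj]
    fin_cases a <;> simp [hf]
  have h := Finset.card_le_card_of_injOn (s := (Finset.univ : Finset (Fin n)))
    (t := Finset.univ.filter fun y => (pathThreePower n).Adj x y)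
    (fun i => Function.update x i (f (x i))) ?_ ?_
  · simpa using h
  · intro i _
    simp only [Finset.coe_filter, Finset.mem_univ, true_and, Set.mem_ofPred_eq]
    refine ⟨i, by simpa using hfa (x i), fun j hj => by simp [hj]⟩
  · intro i _ j _ hij
    by_contra hne
    have := congrFun hij i
    simp only [Function.update_self, Function.update_of_ne hne] at this
    exact (hfa (x i)).ne this.symm

open Classical in
theorem le_card_interedges_compl {n : ℕ} (S : Finset (Fin n → Fin 3)) :
    S.card * (n - Real.logb 2 S.card) ≤ ((pathThreePower n).interedges S Sᶜ).card := by
  set G := pathThreePower n with hG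
  have h1 : S.card * n ≤ (G.interedges S Finset.univ).card := by
    have : G.interedges S Finset.univ =
        (S.sigma fun x => Finset.univ.filter fun y => G.Adj x y).map
          (Equiv.sigmaEquivProd _ _).toEmbedding := by
      ext ⟨u, v⟩
      simp [SimpleGraph.mem_interedges_iff]
    rw [this, Finset.card_map, Finset.card_sigma, ← smul_eq_mul]
    exact Finset.card_nsmul_le_sum _ _ _ fun x _ => le_card_filter_pathThreePower_adj x
  have h2 : G.interedges S Finset.univ ⊆ G.interedges S S ∪ G.interedges S Sᶜ := by
    rintro ⟨u, v⟩ huv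
    simp only [Finset.mem_union, SimpleGraph.mem_interedges_iff, Finset.mem_compl] at huv ⊢
    tauto
  have h3 : (S.card : ℝ) * n ≤ (G.interedges S S).card + (G.interedges S Sᶜ).card := by
    exact_mod_cast h1.trans ((Finset.card_le_card h2).trans (Finset.card_union_le _ _))
  have h4 : ((G.interedges S S).card : ℝ) ≤ S.card * Real.logb 2 S.card :=
    card_interedges_self_le S
  linarith

/-! ### Counting connected sets -/

/-- The vertices visited by the trajectory of `x` under a list of moves. -/
def visited {V M : Type*} [DecidableEq V] (act : M → V → V) : V → List M → Finset V
  | x, [] => {x}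
  | x, m :: l => insert x (visited act (act m x) l)

/-- Splice the detour `u → v → u` into the walk at its first visit to `u`; the rest of the
trajectory is unchanged. -/
lemma exists_visited_eq_insert {V M : Type*} [DecidableEq V] (act : M → V → V) {u v : V} {a b : M}
    (ha : act a u = v) (hb : act b v = u) (x : V) (l : List M) (hu : u ∈ visited act x l) :
    ∃ l' : List M, l'.length = l.length + 2 ∧ visited act x l' = insert v (visited act x l) := by
  have hstart (l : List M) :
      visited act u (a :: b :: l) = insert v (visited act u l) := by
    have hmem : u ∈ visited act u l := by cases l <;> simp [visited]
    simp only [visited, ha, hb]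
    rw [Finset.insert_comm, Finset.insert_eq_of_mem hmem]
  induction l generalizing x with
  | nil =>
    obtain rfl : u = x := by simpa [visited] using hu
    exact ⟨[a, b], rfl, hstart []⟩
  | cons m l ih =>
    rcases eq_or_ne u x with rfl | hux
    · exact ⟨a :: b :: m :: l, rfl, hstart _⟩
    · have hu' : u ∈ visited act (act m x) l := by simpa [visited, hux] using hu
      obtain ⟨l', hl', h⟩ := ih _ hu'
      exact ⟨m :: l', by simp [hl'], by simp only [visited, h]; rw [Finset.insert_comm]⟩

/-- A finite connected set is the set of vertices visited by a walk that traverses every edge of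
a spanning tree twice. -/
lemma exists_visited_eq_of_connected {V M : Type*} [DecidableEq V] (G : SimpleGraph V)
    (act : M → V → V) (hact : ∀ u v, G.Adj u v → ∃ a, act a u = v) (S : Finset V)
    (hS : (G.induce (S : Set V)).Connected) :
    ∃ x, ∃ l : List M, l.length = 2 * (S.card - 1) ∧ visited act x l = S := by
  obtain ⟨⟨x, hx⟩⟩ := hS.nonempty
  have hx : x ∈ S := hx
  refine ⟨x, ?_⟩
  have grow : ∀ k, k + 1 ≤ S.card → ∃ l : List M, l.length = 2 * k ∧ visited act x l ⊆ S ∧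
      (visited act x l).card = k + 1 ∧ x ∈ visited act x l := by
    intro k
    induction k with
    | zero => exact fun _ => ⟨[], by simp [visited, hx]⟩
    | succ k ih =>
      intro hk
      obtain ⟨l, hl, hsub, hcard, hxl⟩ := ih (by omega)
      obtain ⟨w, hwS, hw⟩ := Finset.exists_mem_notMem_of_card_lt_card
        (s := visited act x l) (t := S) (by omega)
      obtain ⟨p⟩ := hS.preconnected ⟨x, hx⟩ ⟨w, hwS⟩
      obtain ⟨d, -, hd, hd'⟩ := p.exists_boundary_dart {z | z.1 ∈ visited act x l} hxl hw
      have hadj : G.Adj d.fst.1 d.snd.1 := d.adj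
      obtain ⟨a, ha⟩ := hact _ _ hadj
      obtain ⟨b, hb⟩ := hact _ _ hadj.symm
      obtain ⟨l', hl', hvis⟩ := exists_visited_eq_insert act ha hb x l hd
      refine ⟨l', by omega, ?_, ?_, ?_⟩
      · rw [hvis]
        exact Finset.insert_subset d.snd.2 hsub
      · rw [hvis, Finset.card_insert_of_notMem hd', hcard]
      · rw [hvis]
        exact Finset.mem_insert_of_mem hxl
  have hpos : 0 < S.card := Finset.card_pos.2 ⟨x, hx⟩
  obtain ⟨l, hl, hsub, hcard, -⟩ := grow (S.card - 1) (by omega)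
  exact ⟨l, hl, Finset.eq_of_subset_of_card_le hsub (by omega)⟩

open Classical in
lemma card_connectedSets_pathThreePower_le (n s : ℕ) :
    (Finset.univ.filter (· ∈ connectedSets (pathThreePower n) s)).card ≤
      3 ^ n * (3 * n) ^ (2 * (s - 1)) := by
  -- A move overwrites one coordinate, so there are `3 * n` moves and every edge is realised by one
  -- of them.
  set act : Fin n × Fin 3 → (Fin n → Fin 3) → (Fin n → Fin 3) :=
    fun a x => Function.update x a.1 a.2
  have hsub : Finset.univ.filter (· ∈ connectedSets (pathThreePower n) s) ⊆
      Finset.univ.image fun z : (Fin n → Fin 3) × List.Vector (Fin n × Fin 3) (2 * (s - 1)) =>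
        visited act z.1 z.2.1 := by
    intro S hS
    obtain ⟨hcard, hconn⟩ := (Finset.mem_filter.1 hS).2
    have hact (u v : Fin n → Fin 3) (huv : (pathThreePower n).Adj u v) : ∃ a, act a u = v := by
      obtain ⟨i, -, h⟩ := huv
      refine ⟨(i, v i), funext fun j => ?_⟩
      rcases eq_or_ne j i with rfl | hj
      · simp [act]
      · simp [act, hj, h j hj]
    obtain ⟨x, l, hl, h⟩ := exists_visited_eq_of_connected (pathThreePower n) act hact S hconn
    exact Finset.mem_image.2 ⟨(x, ⟨l, by rw [hl, hcard]⟩), Finset.mem_univ _, h⟩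
  refine (Finset.card_le_card hsub).trans (Finset.card_image_le.trans ?_)
  rw [Finset.card_univ, Fintype.card_prod, card_vector, Fintype.card_prod, Fintype.card_fun,
    Fintype.card_fin, Fintype.card_fin, mul_comm n 3]

/-! ### Probability that a set is separated -/

lemma setBernoulli_disjoint {ι : Type*} {u : Set ι} (p : unitInterval) (F : Finset ι)
    (hF : ∀ i ∈ F, i ∈ u) :
    setBernoulli u p {t | ∀ i ∈ F, i ∉ t} =
      (unitInterval.toNNReal (unitInterval.symm p) : ENNReal) ^ F.card := by
  rw [setBernoulli_apply']
  have h : ((fun q : ι → Prop => {i | q i}) ⁻¹' {t | ∀ i ∈ F, i ∉ t}) =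
      Set.pi F fun _ => {False} := by
    ext q
    simp
  rw [h, Measure.infinitePi_pi _ (fun _ _ => MeasurableSet.of_discrete), Finset.prod_congr rfl
    (g := fun _ => (unitInterval.toNNReal (unitInterval.symm p) : ENNReal)), Finset.prod_const]
  intro i hi
  simp [hF i hi]

open Classical in
lemma randomSubgraph_isSeparated_le {V : Type*} [Fintype V] [DecidableEq V] (G : SimpleGraph V)
    (p : unitInterval) (S : Finset V) :
    randomSubgraph G p {H | IsSeparated H S} ≤
      (unitInterval.toNNReal (unitInterval.symm p) : ENNReal) ^ (G.interedges S Sᶜ).card := by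
  set F : Finset (Sym2 V) := (G.interedges S Sᶜ).image fun z => s(z.1, z.2) with hF
  have hcard : F.card = (G.interedges S Sᶜ).card := by
    -- Only one endpoint lies in `S`, so the unordered edge determines the ordered pair.
    refine Finset.card_image_of_injOn ?_
    rintro ⟨x, y⟩ hz ⟨x', y'⟩ hz' h
    simp only [Finset.mem_coe, SimpleGraph.mem_interedges_iff, Finset.mem_compl] at hz hz'
    rcases Sym2.eq_iff.1 h with ⟨rfl, rfl⟩ | ⟨rfl, rfl⟩
    · rfl
    · exact absurd hz.1 hz'.2.1
  have hmeas : MeasurableSet {H : SimpleGraph V | IsSeparated H S} := by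
    have : {H : SimpleGraph V | IsSeparated H S} =
        ⋂ u ∈ S, ⋂ v ∈ Sᶜ, {H | ¬ H.Adj u v} := by
      ext H
      simp [IsSeparated]
    rw [this]
    refine Finset.measurableSet_biInter _ fun u _ => Finset.measurableSet_biInter _ fun v _ => ?_
    exact ((SimpleGraph.measurable_iff_adj.1 measurable_id u v).setOf).compl
  rw [randomSubgraph, Measure.map_apply SimpleGraph.measurable_fromEdgeSet hmeas, ← hcard,
    ← setBernoulli_disjoint (u := G.edgeSet) p F ?_]
  · refine measure_mono fun t ht e he het => ?_
    obtain ⟨⟨x, y⟩, hxy, rfl⟩ := Finset.mem_image.1 he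
    obtain ⟨hx, hy, hadj⟩ := (SimpleGraph.mem_interedges_iff _).1 hxy
    exact ht x hx y (Finset.mem_compl.1 hy) ((SimpleGraph.fromEdgeSet_adj t).2 ⟨het, hadj.ne⟩)
  · intro e he
    obtain ⟨⟨x, y⟩, hxy, rfl⟩ := Finset.mem_image.1 he
    exact ((SimpleGraph.mem_interedges_iff _).1 hxy).2.2

/-! ### The union bound -/

lemma toNNReal_symm_le {p : unitInterval} (hp : 2 - √2 ≤ (p : ℝ)) :
    (unitInterval.toNNReal (unitInterval.symm p) : ENNReal) ≤ ENNReal.ofReal 0.42 := by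
  have h : √2 ≤ 1.42 := Real.sqrt_le_iff.2 (by norm_num)
  rw [ENNReal.ofReal, ENNReal.coe_le_coe, ← NNReal.coe_le_coe, Real.coe_toNNReal _ (by norm_num),
    unitInterval.coe_toNNReal, unitInterval.coe_symm_eq]
  linarith

lemma randomSubgraph_exists_isSeparated_le {p : unitInterval} (hp : 2 - √2 ≤ (p : ℝ)) {n s : ℕ}
    {r c : ℝ} (hr : 0 ≤ r) (hn : 1 ≤ n) (hs : 1 ≤ s)
    (hc : Real.logb 2 s ≤ c) (hrc : (0.42 : ℝ) ^ (n - c) ≤ r) :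
    randomSubgraph (pathThreePower n) p
        {H | ∃ S ∈ connectedSets (pathThreePower n) s, IsSeparated H S} ≤
      ENNReal.ofReal (3 ^ n * (9 * n ^ 2 * r) ^ s) := by
  classical
  have hunion : {H | ∃ S ∈ connectedSets (pathThreePower n) s, IsSeparated H S} =
      ⋃ S ∈ Finset.univ.filter (· ∈ connectedSets (pathThreePower n) s),
        {H | IsSeparated H S} := by
    ext H
    simp
  have hS : ∀ S ∈ Finset.univ.filter (· ∈ connectedSets (pathThreePower n) s),
      randomSubgraph (pathThreePower n) p {H | IsSeparated H S} ≤ ENNReal.ofReal (r ^ s) := by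
    intro S hS
    obtain ⟨rfl, -⟩ := (Finset.mem_filter.1 hS).2
    refine (randomSubgraph_isSeparated_le _ p S).trans
      ((pow_le_pow_left' (toNNReal_symm_le hp) _).trans ?_)
    rw [← ENNReal.ofReal_pow (by norm_num)]
    refine ENNReal.ofReal_le_ofReal ?_
    calc (0.42 : ℝ) ^ ((pathThreePower n).interedges S Sᶜ).card
        = (0.42 : ℝ) ^ (((pathThreePower n).interedges S Sᶜ).card : ℝ) :=
          (Real.rpow_natCast _ _).symm
      _ ≤ (0.42 : ℝ) ^ ((n - c) * S.card) := by
          refine Real.rpow_le_rpow_of_exponent_ge (by norm_num) (by norm_num)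
            (le_trans ?_ (le_card_interedges_compl S))
          rw [mul_comm]
          gcongr
      _ = ((0.42 : ℝ) ^ (n - c)) ^ S.card := Real.rpow_mul_natCast (by norm_num) _ _
      _ ≤ r ^ S.card := by gcongr
  rw [hunion]
  refine (measure_biUnion_finset_le _ _).trans ((Finset.sum_le_card_nsmul _ _ _ hS).trans ?_)
  rw [nsmul_eq_mul, ← ENNReal.ofReal_natCast, ← ENNReal.ofReal_mul (Nat.cast_nonneg _)]
  refine ENNReal.ofReal_le_ofReal ?_
  rw [mul_pow, ← mul_assoc]
  gcongr
  calc ((Finset.univ.filter (· ∈ connectedSets (pathThreePower n) s)).card : ℝ)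
      ≤ ((3 ^ n * (3 * n) ^ (2 * (s - 1)) : ℕ) : ℝ) :=
        Nat.cast_le.2 (card_connectedSets_pathThreePower_le n s)
    _ ≤ ((3 ^ n * (3 * n) ^ (2 * s) : ℕ) : ℝ) := by
        refine Nat.cast_le.2 ?_
        gcongr <;> omega
    _ = 3 ^ n * (9 * n ^ 2) ^ s := by
        push_cast
        rw [pow_mul]
        ring

lemma rpow_three_tenths_le : (0.42 : ℝ) ^ (0.3 : ℝ) ≤ 0.78 := by
  -- Reduces to `0.42 ^ 3 ≤ 0.78 ^ 10`.
  refine le_of_pow_le_pow_left₀ (n := 10) (by norm_num) (by norm_num) ?_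
  rw [← Real.rpow_mul_natCast (by norm_num)]
  norm_num

lemma logb_two_le_of_le_rpow {s n : ℕ} (hs : 1 ≤ s)
    (h : (s : ℝ) ≤ (3 : ℝ) ^ ((0.44 : ℝ) * (n : ℝ))) : Real.logb 2 s ≤ 0.7 * n := by
  rw [Real.logb_le_iff_le_rpow one_lt_two (by exact_mod_cast hs), Real.rpow_mul (by norm_num)]
  rw [Real.rpow_mul (by norm_num)] at h
  refine h.trans (Real.rpow_le_rpow (by positivity) ?_ (Nat.cast_nonneg n))
  -- Reduces to `3 ^ 44 ≤ 2 ^ 70`.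
  refine le_of_pow_le_pow_left₀ (n := 100) (by norm_num) (by positivity) ?_
  rw [← Real.rpow_mul_natCast (by norm_num), ← Real.rpow_mul_natCast (by norm_num)]
  norm_num

lemma tendsto_three_pow_mul_pow {C t : ℝ} {k : ℕ} (ht : 0 ≤ t) (h : 3 * t ^ k < 1) :
    Tendsto (fun n : ℕ => 3 ^ n * (C * n ^ 2 * t ^ n) ^ k) atTop (𝓝 0) := by
  have h1 := (tendsto_pow_const_mul_const_pow_of_abs_lt_one (2 * k) (r := 3 * t ^ k)
    (by rwa [abs_of_nonneg (by positivity)])).const_mul (C ^ k)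
  rw [mul_zero] at h1
  refine h1.congr fun n => ?_
  simp only [mul_pow, ← pow_mul]
  rw [mul_comm k n]
  ring

/-- Sets aside a factor `(1 / 2) ^ s`, making the union bound over `s` a geometric series. -/
lemma pow_le_pow_mul_half_pow {x : ℝ} {j s : ℕ} (h0 : 0 ≤ x) (h1 : 2 * x ≤ 1) (hjs : j ≤ s) :
    x ^ s ≤ (2 * x) ^ j * (1 / 2) ^ s := by
  calc x ^ s = (2 * x) ^ s * (1 / 2) ^ s := by rw [← mul_pow]; ring
    _ ≤ (2 * x) ^ j * (1 / 2) ^ s := by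
      gcongr ?_ * _
      exact pow_le_pow_of_le_one (by positivity) h1 hjs

theorem mainTheorem10 (p : unitInterval) (hp : 2 - √2 ≤ (p : ℝ)) :
    Tendsto
      (fun n : ℕ => randomSubgraph (pathThreePower n) p
        {H | ∃ s : ℕ, 2 ≤ s ∧ (s : ℝ) ≤ (3 : ℝ) ^ ((0.44 : ℝ) * (n : ℝ)) ∧
          ∃ S ∈ connectedSets (pathThreePower n) s, IsSeparated H S})
      atTop (𝓝 0) := by
  -- `x n` governs the sets with at most `16` vertices, `y n` the larger ones.
  set C : ℝ := 9 / 0.42 ^ 4 with hC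
  set x : ℕ → ℝ := fun n => C * n ^ 2 * 0.42 ^ n with hx
  set y : ℕ → ℝ := fun n => 9 * n ^ 2 * 0.78 ^ n with hy
  have hx0 : ∀ n, 0 ≤ x n := fun n => by positivity
  have hy0 : ∀ n, 0 ≤ y n := fun n => by positivity
  have hlim (D t : ℝ) (h0 : 0 ≤ t) (h1 : t < 1) :
      Tendsto (fun n : ℕ => 2 * (D * n ^ 2 * t ^ n)) atTop (𝓝 0) := by
    have := (tendsto_pow_const_mul_const_pow_of_abs_lt_one 2
      (by rwa [abs_of_nonneg h0])).const_mul (2 * D)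
    rw [mul_zero] at this
    exact this.congr fun n => by ring
  have hx1 : ∀ᶠ n in atTop, 2 * x n < 1 :=
    (hlim C 0.42 (by norm_num) (by norm_num)).eventually_lt_const one_pos
  have hy1 : ∀ᶠ n in atTop, 2 * y n < 1 :=
    (hlim 9 0.78 (by norm_num) (by norm_num)).eventually_lt_const one_pos
  -- The exponents bound `s` from below in the two ranges; decay needs `3 * 0.42 ^ 2 < 1` and `3 *
  -- 0.78 ^ 16 < 1`.
  set A : ℕ → ℝ := fun n => 3 ^ n * (2 * x n) ^ 2 + 3 ^ n * (2 * y n) ^ 16 with hA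
  have hA0 : Tendsto A atTop (𝓝 0) := by
    have h1 := (tendsto_three_pow_mul_pow (C := 2 * C) (t := 0.42) (k := 2) (by norm_num)
      (by norm_num)).add (tendsto_three_pow_mul_pow (C := 2 * 9) (t := 0.78) (k := 16)
      (by norm_num) (by norm_num))
    rw [add_zero] at h1
    refine h1.congr fun n => ?_
    simp only [hA, hx, hy, mul_assoc]
  have hlimA : Tendsto (fun n => ENNReal.ofReal (A n) * 2) atTop (𝓝 0) := by
    have := ENNReal.Tendsto.mul_const (b := 2) (ENNReal.tendsto_ofReal hA0) (Or.inr (by simp))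
    simpa using this
  refine tendsto_of_tendsto_of_tendsto_of_le_of_le' tendsto_const_nhds hlimA
    (Eventually.of_forall fun _ => zero_le) ?_
  filter_upwards [hx1, hy1, eventually_ge_atTop 1] with n hxn hyn hn
  have hs (s : ℕ) : randomSubgraph (pathThreePower n) p
      {H | 2 ≤ s ∧ (s : ℝ) ≤ (3 : ℝ) ^ ((0.44 : ℝ) * (n : ℝ)) ∧
        ∃ S ∈ connectedSets (pathThreePower n) s, IsSeparated H S} ≤
      ENNReal.ofReal (A n) * 2⁻¹ ^ s := by
    by_cases h : 2 ≤ s ∧ (s : ℝ) ≤ (3 : ℝ) ^ ((0.44 : ℝ) * (n : ℝ))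
    swap
    · have : {H | 2 ≤ s ∧ (s : ℝ) ≤ (3 : ℝ) ^ ((0.44 : ℝ) * (n : ℝ)) ∧
        ∃ S ∈ connectedSets (pathThreePower n) s, IsSeparated H S} = ∅ :=
        Set.eq_empty_of_forall_notMem fun H hH => h ⟨hH.1, hH.2.1⟩
      simp [this]
    have hhalf : (2⁻¹ : ENNReal) ^ s = ENNReal.ofReal ((1 / 2) ^ s) := by
      rw [ENNReal.ofReal_pow (by norm_num), one_div, ENNReal.ofReal_inv_of_pos two_pos]
      simp
    rw [hhalf, ← ENNReal.ofReal_mul (by positivity)]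
    refine (measure_mono fun H hH => hH.2.2).trans ?_
    rcases le_or_gt s 16 with hs16 | hs16
    · refine (randomSubgraph_exists_isSeparated_le hp (c := 4) (r := 0.42 ^ n / 0.42 ^ 4)
        (by positivity) hn (by omega) ?_ ?_).trans (ENNReal.ofReal_le_ofReal ?_)
      · rw [Real.logb_le_iff_le_rpow one_lt_two (by exact_mod_cast (by omega : 0 < s))]
        have : (s : ℝ) ≤ 16 := by exact_mod_cast hs16
        exact this.trans (by norm_num)
      · rw [Real.rpow_sub (by norm_num), Real.rpow_natCast]
        norm_num
      · have h1 : 9 * (n : ℝ) ^ 2 * (0.42 ^ n / 0.42 ^ 4) = x n := by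
          simp only [hx, hC]
          ring
        rw [h1]
        calc 3 ^ n * x n ^ s ≤ 3 ^ n * ((2 * x n) ^ 2 * (1 / 2) ^ s) := by
              gcongr
              exact pow_le_pow_mul_half_pow (hx0 n) hxn.le h.1
          _ ≤ A n * (1 / 2) ^ s := by
              rw [← mul_assoc]
              gcongr
              exact le_add_of_nonneg_right (by have := hy0 n; positivity)
    · refine (randomSubgraph_exists_isSeparated_le hp (c := 0.7 * n) (r := 0.78 ^ n)
        (by positivity) hn (by omega) (logb_two_le_of_le_rpow (by omega) h.2) ?_).trans
        (ENNReal.ofReal_le_ofReal ?_)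
      · have h1 : (n : ℝ) - 0.7 * n = 0.3 * n := by ring
        rw [h1, Real.rpow_mul_natCast (by norm_num)]
        exact pow_le_pow_left₀ (by positivity) rpow_three_tenths_le n
      · calc 3 ^ n * y n ^ s ≤ 3 ^ n * ((2 * y n) ^ 16 * (1 / 2) ^ s) := by
              gcongr
              exact pow_le_pow_mul_half_pow (hy0 n) hyn.le hs16.le
          _ ≤ A n * (1 / 2) ^ s := by
              rw [← mul_assoc]
              gcongr
              exact le_add_of_nonneg_left (by have := hx0 n; positivity)
  calc _ ≤ randomSubgraph (pathThreePower n) p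
        (⋃ s : ℕ, {H | 2 ≤ s ∧ (s : ℝ) ≤ (3 : ℝ) ^ ((0.44 : ℝ) * (n : ℝ)) ∧
          ∃ S ∈ connectedSets (pathThreePower n) s, IsSeparated H S}) :=
        measure_mono fun H hH => Set.mem_iUnion.2 hH
    _ ≤ ∑' s : ℕ, ENNReal.ofReal (A n) * 2⁻¹ ^ s :=
        (measure_iUnion_le _).trans (ENNReal.tsum_le_tsum hs)
    _ = ENNReal.ofReal (A n) * 2 := by
        rw [ENNReal.tsum_mul_left, ENNReal.tsum_geometric, ENNReal.one_sub_inv_two, inv_inv]
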